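/- There is an absolute constant $C>0$ such that the following holds. Let $(A,q,r)$ be a quantization of $\mathbb R^d$: $A$ is a finite set of atoms, and $r:A\to\mathbb R^d$ and $q:\mathbb R^d\to A$ are maps with $q(r(a))=a$ for all $a\in A$. Let $\mathcal F$ be a class of binary-valued functions (separators) on $A$, and let $\mathcal F'$ be a real extension of $\mathcal F$, that is, a class of binary-valued functions on $\mathbb R^d$ such that every $F\in\mathcal F$ is of the form $G\circ r$ for some $G\in\mathcal F'$, and $G\circ r\in\mathcal F$ for every $G\in\mathcal F'$. Suppose that $(\mathbb R^d,\mathcal F')$ has VC-dimension at most $\nu$, where $\nu\ge 1$ is an integer. Let $X\subseteq A$ be a non-empty set of examples with binary labels $y$, and let $\varepsilon,\delta\in(0,1)$ with $\varepsilon\delta\le\frac12$. Let $(X_1,y_1)$ and $(X_2,y_2)$ be random samples from $(X,y)$, each consisting of independent uniform draws from $X$ with their labels (the two samples may depend on each other), of sizes $$n_1\ \ge\ C\,\frac{\nu}{\varepsilon}\log\frac{1}{\varepsilon\delta},\qquad n_2\ \ge\ C\,\frac{1}{\varepsilon^2}\Bigl(\nu+\log\frac1\delta\Bigr).$$ Then,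 with probability at least $1-\delta$, the following hold simultaneously: 1. every $F_1\in\mathcal F$ that classifies all of $(X_1,y_1)$ correctly misclassifies at most an $\varepsilon$ fraction of the points of $(X,y)$; 2. every $F_2\in\mathcal F$ that misclassifies an $\eta$ fraction of the points of $(X_2,y_2)$ misclassifies at most an $\eta+\varepsilon$ fraction of the points of $(X,y)$. -/

import Mathlib

open MeasureTheory ProbabilityTheory

/-- A quantization `(A, q, r)` of `ℝ^d`: every atom `a : A` represents the point `r a` (its
restoration), every point is rounded by `q` to an atom, and atoms are represented exactly.
Finiteness of the set of atoms is the class `[Finite A]`. -/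
structure Quantization (d : ℕ) (A : Type*) [Finite A] where
  q : EuclideanSpace ℝ (Fin d) → A
  r : A → EuclideanSpace ℝ (Fin d)
  q_r : ∀ a, q (r a) = a

/-- `𝓕'` is a real extension of the class `𝓕` of binary functions on the atoms: every `F ∈ 𝓕` is
extended by some member of `𝓕'`, and every member of `𝓕'` agrees on all the atoms with some member
of `𝓕`. The class `{r(F) | F ∈ 𝓕}` satisfies this for every choice of one extension `r(F)` of each
`F`, and so does the class of all extensions of members of `𝓕`. -/
def IsRealExtension {d : ℕ} {A : Type*} [Finite A] (Q : Quantization d A)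
    (𝓕 : Set (A → Bool)) (𝓕' : Set (EuclideanSpace ℝ (Fin d) → Bool)) : Prop :=
  (∀ F ∈ 𝓕, ∃ G ∈ 𝓕', ∀ a, G (Q.r a) = F a) ∧
  (∀ G ∈ 𝓕', ∃ F ∈ 𝓕, ∀ a, G (Q.r a) = F a)

/-- The class `𝓖` of binary functions realizes every labeling of the finite set `S`. -/
def ClassShatters {α : Type*} (𝓖 : Set (α → Bool)) (S : Finset α) : Prop :=
  ∀ l : α → Bool, ∃ G ∈ 𝓖, ∀ x ∈ S, G x = l x

/-- The VC-dimension: the supremum, possibly infinite, of the sizes of the shattered sets. -/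
noncomputable def vcDimension {α : Type*} (𝓖 : Set (α → Bool)) : ℕ∞ :=
  ⨆ (S : Finset α) (_ : ClassShatters 𝓖 S), (S.card : ℕ∞)

/-- The fraction of the labeled examples `(x i, y i)`, `i : ι`, that `F` misclassifies. -/
noncomputable def misclassifiedFraction {A ι : Type*} [Fintype ι] (F : A → Bool)
    (x : ι → A) (y : ι → Bool) : ℝ :=
  ((Finset.univ.filter fun i => F (x i) ≠ y i).card : ℝ) / (Fintype.card ι : ℝ)

/-- `ξ 0, …, ξ (n - 1)` are independent random elements, each uniformly distributed on the finite
type `X` with its discrete σ-algebra. -/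
structure IsUniformSample {Ω X : Type*} [MeasurableSpace Ω] [Fintype X] (P : Measure Ω)
    {n : ℕ} (ξ : Fin n → Ω → X) : Prop where
  measurable : ∀ i (s : Set X), MeasurableSet (ξ i ⁻¹' s)
  uniform : ∀ i x, P.real {ω | ξ i ω = x} = 1 / (Fintype.card X : ℝ)
  indep : iIndepFun (m := fun _ => (⊤ : MeasurableSpace X)) ξ P

/-! The VC bound passes from `𝓕'` to the class of error indicators `x ↦ [F x ≠ y x]` on the examples
and to all traces of that class on finite samples (`HasVCBound.comp`, `HasVCBound.xor`), so the
extension and the geometry of `ℝ^d` play no further role. Both claims then say that few of the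
`#X ^ n` samples are bad, and they are proved by counting; `IsUniformSample.measureReal_mem_le`
transfers the counts to the probability space, and a union bound joins the two claims.

Both counts begin with symmetrization (`card_le_of_swapPairs`). For a bad sample, at least half of
all second samples see the offending function close to its mean, by a Chernoff bound. So it is
enough to fix a double sample of `2 n` points and to count the exchanges of its pairs which make
the two halves differ much on some trace of the class.

* For consistent functions (`exists_small_forall_missed_mean_le`) a single trace with `s` hits in
  the second half and none in the first survives only `2 ^ (n - s)` exchanges, with `s = n ε / 2`.
  A union bound over all traces suffices, their number being bounded by the Sauer–Shelah lemma in
  the form `#𝒯 * x ^ ν ≤ (1 + x) ^ (2 n)` with `x` proportional to `ε`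
  (`card_mul_pow_le_of_hasVCBound`).
* For the additive error (`exists_small_forall_mean_le`) that union bound would cost a factor
  `log (1 / ε)` in the sample size, and chaining avoids it (`exists_small_forall_signedDiff_le`).
  Dudley's packing bound (`log_card_le_of_separated`) gives nets of the traces at Hamming scale
  `4 ^ (-j)` of logarithmic size `O (ν (j + 1))`. Each trace is reached from the empty one along
  these nets. The increments of level `j` have variance at most of order `4 ^ (-j) n` under random
  exchanges, so by Hoeffding's inequality they are all below `(3 / 4) ^ j n ε / 8` except with
  probability `(δ / 8) ^ (j + 1)`, and the thresholds add up to at most `n ε / 2`.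
-/

/-! ### Classes of bounded VC-dimension -/

section VCBound

open Finset

/-- Every set shattered by the class `𝓖` has at most `ν` points. This is the bound
`vcDimension 𝓖 ≤ ν`, without the supremum. -/
def HasVCBound {α : Type*} (𝓖 : Set (α → Bool)) (ν : ℕ) : Prop :=
  ∀ S : Finset α, ClassShatters 𝓖 S → #S ≤ ν

theorem hasVCBound_of_vcDimension_le {α : Type*} {𝓖 : Set (α → Bool)} {ν : ℕ}
    (h : vcDimension 𝓖 ≤ ν) : HasVCBound 𝓖 ν := fun S hS => by
  have : (#S : ℕ∞) ≤ vcDimension 𝓖 :=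
    le_iSup₂ (f := fun (S : Finset α) (_ : ClassShatters 𝓖 S) => (#S : ℕ∞)) S hS
  exact_mod_cast this.trans h

theorem HasVCBound.mono {α : Type*} {𝓖 𝓗 : Set (α → Bool)} {ν : ℕ} (h : HasVCBound 𝓖 ν)
    (hsub : 𝓗 ⊆ 𝓖) : HasVCBound 𝓗 ν := fun S hS =>
  h S fun l => let ⟨G, hG, hl⟩ := hS l; ⟨G, hsub hG, hl⟩

/-- Pulling a class back along any map `f` cannot increase the size of shattered sets, because `f`
is injective on a set shattered by the pullback. -/
theorem HasVCBound.comp {α β : Type*} {𝓖 : Set (α → Bool)} {ν : ℕ} (h : HasVCBound 𝓖 ν)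
    (f : β → α) : HasVCBound ((fun G => G ∘ f) '' 𝓖) ν := fun S hS => by
  classical
  have hinj : Set.InjOn f S := by
    intro i hi j hj hij
    obtain ⟨_, ⟨G, -, rfl⟩, hl⟩ := hS fun k => decide (k = i)
    have h1 := hl i hi
    have h2 := hl j hj
    simp only [Function.comp_apply, hij, decide_true] at h1 h2
    rw [h1] at h2
    exact (of_decide_eq_true h2.symm).symm
  rw [← card_image_of_injOn hinj]
  refine h _ fun l => ?_
  obtain ⟨_, ⟨G, hG, rfl⟩, hl⟩ := hS (l ∘ f)
  refine ⟨G, hG, fun x hx => ?_⟩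
  obtain ⟨i, hi, rfl⟩ := mem_image.1 hx
  exact hl i hi

theorem HasVCBound.xor {α : Type*} {𝓖 : Set (α → Bool)} {ν : ℕ} (h : HasVCBound 𝓖 ν)
    (y : α → Bool) : HasVCBound ((fun G x => G x ^^ y x) '' 𝓖) ν := fun S hS =>
  h S fun l => by
    obtain ⟨_, ⟨G, hG, rfl⟩, hl⟩ := hS fun x => l x ^^ y x
    exact ⟨G, hG, fun x hx => by simpa using hl x hx⟩

/-- The Sauer–Shelah bound in generating function form. Pajor's inequality bounds the size of the
class by the number of shattered sets, and each of these contributes at least `x ^ ν` to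
`∑ S, x ^ #S = (1 + x) ^ m`. -/
theorem card_mul_pow_le_of_hasVCBound {ι : Type*} [Fintype ι] (𝒯 : Finset (ι → Bool)) {ν : ℕ}
    (h : HasVCBound (𝒯 : Set (ι → Bool)) ν) {x : ℝ} (hx0 : 0 < x) (hx1 : x ≤ 1) :
    (#𝒯 : ℝ) * x ^ ν ≤ (1 + x) ^ Fintype.card ι := by
  classical
  set e : (ι → Bool) → Finset ι := fun h => univ.filter fun i => h i = true with he
  have einj : Function.Injective e := by
    intro g h hgh
    funext i
    have := congrArg (fun s => i ∈ s) hgh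
    simp only [he, mem_filter, mem_univ, true_and, eq_iff_iff] at this
    exact Bool.eq_iff_iff.2 this
  have hcard : #𝒯 ≤ #(𝒯.image e).shatterer :=
    (card_image_of_injective 𝒯 einj).symm.le.trans (card_le_card_shatterer _)
  have hsh : ∀ S ∈ (𝒯.image e).shatterer, #S ≤ ν := by
    intro S hS
    rw [mem_shatterer] at hS
    refine h S fun l => ?_
    obtain ⟨u, hu, hSu⟩ := hS (filter_subset (fun i => l i = true) S)
    obtain ⟨g, hg, rfl⟩ := mem_image.1 hu
    refine ⟨g, hg, fun i hi => ?_⟩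
    have := congrArg (fun s => i ∈ s) hSu
    simp only [he, mem_inter, mem_filter, mem_univ, true_and, hi, eq_iff_iff] at this
    exact Bool.eq_iff_iff.2 this
  calc (#𝒯 : ℝ) * x ^ ν ≤ #(𝒯.image e).shatterer * x ^ ν := by gcongr
    _ = ∑ S ∈ (𝒯.image e).shatterer, x ^ ν := by simp
    _ ≤ ∑ S ∈ (𝒯.image e).shatterer, x ^ #S :=
        sum_le_sum fun S hS => pow_le_pow_of_le_one hx0.le hx1 (hsh S hS)
    _ ≤ ∑ S : Finset ι, x ^ #S :=
        sum_le_sum_of_subset_of_nonneg (subset_univ _) fun _ _ _ => by positivity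
    _ = (1 + x) ^ Fintype.card ι := by
        have := Fintype.sum_pow_mul_eq_add_pow ι x 1
        simpa [add_comm] using this

theorem log_card_le_of_hasVCBound {ι : Type*} [Fintype ι] {𝒯 : Finset (ι → Bool)} {ν : ℕ}
    (h : HasVCBound (𝒯 : Set (ι → Bool)) ν) (h𝒯 : 0 < #𝒯) {x : ℝ} (hx0 : 0 < x) (hx1 : x ≤ 1) :
    Real.log #𝒯 ≤ ν * Real.log (1 / x) + x * Fintype.card ι := by
  have h0 : (0 : ℝ) < #𝒯 := by exact_mod_cast h𝒯
  have h1 := Real.log_le_log (by positivity) (card_mul_pow_le_of_hasVCBound 𝒯 h hx0 hx1)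
  rw [Real.log_mul h0.ne' (by positivity), Real.log_pow, Real.log_pow] at h1
  have h2 : Real.log (1 + x) ≤ x := by
    have := Real.log_le_sub_one_of_pos (show 0 < 1 + x by linarith)
    linarith
  have h3 : (Fintype.card ι : ℝ) * Real.log (1 + x) ≤ Fintype.card ι * x := by gcongr
  rw [one_div, Real.log_inv]
  linarith

end VCBound

/-! ### Packing numbers and nets -/

section Packing

open Finset

/-- If `m` is large compared with `log #𝒯 / α`, then some `m`-tuple of coordinates (a random one,
with positive probability) tells all members of an `α`-separated family apart. -/
theorem exists_injOn_comp_of_separated {ι : Type*} [Fintype ι] (𝒯 : Finset (ι → Bool)) {α : ℝ}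
    (hα : α ≤ 1)
    (hsep : ∀ g ∈ 𝒯, ∀ h ∈ 𝒯, g ≠ h → α * Fintype.card ι < hammingDist g h)
    (hcard : 2 ≤ #𝒯) {m : ℕ} (hm : 2 * Real.log #𝒯 ≤ α * m) :
    ∃ s : Fin m → ι, Set.InjOn (fun g : ι → Bool => g ∘ s) 𝒯 := by
  classical
  by_contra! hcon
  have hN : (0 : ℝ) < #𝒯 := by exact_mod_cast (by omega : 0 < #𝒯)
  have hι : 0 < Fintype.card ι := by
    obtain ⟨g, hg, h, hh, hne⟩ := one_lt_card.1 hcard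
    rw [Fintype.card_pos_iff]
    by_contra hemp
    rw [not_nonempty_iff] at hemp
    exact hne (Subsingleton.elim _ _)
  have hM : (0 : ℝ) < Fintype.card ι := by exact_mod_cast hι
  set bad : (ι → Bool) × (ι → Bool) → Finset (Fin m → ι) := fun p =>
    Fintype.piFinset fun _ => univ.filter fun i => p.1 i = p.2 i with hbad
  have hcover : (univ : Finset (Fin m → ι)) ⊆ 𝒯.offDiag.biUnion bad := by
    intro s _
    have := hcon s
    simp only [Set.InjOn, not_forall] at this
    obtain ⟨g, hg, h, hh, hgh, hne⟩ := this
    refine mem_biUnion.2 ⟨(g, h), mem_offDiag.2 ⟨hg, hh, hne⟩, ?_⟩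
    exact Fintype.mem_piFinset.2 fun k => by simpa using congrFun hgh k
  have hbadcard : ∀ p ∈ 𝒯.offDiag, (#(bad p) : ℝ) ≤ ((1 - α) * Fintype.card ι) ^ m := by
    rintro ⟨g, h⟩ hp
    rw [mem_offDiag] at hp
    simp only [hbad, Fintype.card_piFinset, prod_const, card_univ, Fintype.card_fin]
    push_cast
    gcongr
    have h1 := hsep g hp.1 h hp.2.1 hp.2.2
    have h2 : #(univ.filter fun i => g i = h i) + hammingDist g h = Fintype.card ι := by
      rw [hammingDist, ← card_univ]
      exact card_filter_add_card_filter_not _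
    have h3 : (#(univ.filter fun i => g i = h i) : ℝ) + hammingDist g h = Fintype.card ι := by
      exact_mod_cast h2
    linarith
  have h1 : ((Fintype.card ι : ℝ)) ^ m ≤ #𝒯.offDiag * ((1 - α) * Fintype.card ι) ^ m := by
    have e1 : Fintype.card ι ^ m ≤ ∑ p ∈ 𝒯.offDiag, #(bad p) := by
      have := (card_le_card hcover).trans card_biUnion_le
      simpa using this
    calc ((Fintype.card ι : ℝ)) ^ m ≤ ∑ p ∈ 𝒯.offDiag, (#(bad p) : ℝ) := by exact_mod_cast e1
      _ ≤ ∑ p ∈ 𝒯.offDiag, ((1 - α) * Fintype.card ι) ^ m := sum_le_sum hbadcard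
      _ = _ := by simp
  have h2 : (1 : ℝ) ≤ #𝒯.offDiag * (1 - α) ^ m := by
    rw [mul_pow, ← mul_assoc] at h1
    exact le_of_mul_le_mul_right (by simpa using h1) (pow_pos hM m)
  have h3 : (1 - α) ^ m ≤ 1 / (#𝒯 : ℝ) ^ 2 := by
    calc (1 - α) ^ m ≤ Real.exp (-α) ^ m := by
          have := Real.add_one_le_exp (-α)
          gcongr
          · linarith
      _ = Real.exp (-(α * m)) := by rw [← Real.exp_nat_mul]; ring_nf
      _ ≤ Real.exp (-(2 * Real.log #𝒯)) := by gcongr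
      _ = _ := by
        rw [Real.exp_neg, two_mul, Real.exp_add, Real.exp_log hN]; field_simp
  have h4 : (#𝒯.offDiag : ℝ) < (#𝒯 : ℝ) ^ 2 := by
    have : #𝒯.offDiag < #𝒯 ^ 2 := by
      rw [offDiag_card, sq]
      have : 0 < #𝒯 * #𝒯 := by positivity
      omega
    exact_mod_cast this
  have h5 : (#𝒯.offDiag : ℝ) * (1 - α) ^ m ≤ #𝒯.offDiag * (1 / (#𝒯 : ℝ) ^ 2) := by gcongr
  have h6 : (#𝒯.offDiag : ℝ) * (1 / (#𝒯 : ℝ) ^ 2) < 1 := by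
    rw [mul_one_div, div_lt_one (by positivity)]
    exact h4
  linarith

/-- Dudley's packing bound. A random set of about `log #𝒯 / α` coordinates separates `𝒯`, so the
Sauer–Shelah bound applies to the trace on few coordinates; with `x = α / 4` it bounds `log #𝒯` by
half of itself plus half of the stated quantity. -/
theorem log_card_le_of_separated {ι : Type*} [Fintype ι] (𝒯 : Finset (ι → Bool)) {ν : ℕ}
    (hvc : HasVCBound (𝒯 : Set (ι → Bool)) ν) {α : ℝ} (hα0 : 0 < α) (hα : α ≤ 1)
    (hsep : ∀ g ∈ 𝒯, ∀ h ∈ 𝒯, g ≠ h → α * Fintype.card ι < hammingDist g h) :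
    Real.log #𝒯 ≤ 2 * ν * Real.log (4 / α) + 1 / 2 := by
  classical
  have hlog : 0 ≤ Real.log (4 / α) := Real.log_nonneg (by rw [le_div_iff₀ hα0]; linarith)
  rcases lt_or_ge #𝒯 2 with hc | hc
  · have : Real.log #𝒯 = 0 := by interval_cases #𝒯 <;> simp
    rw [this]
    positivity
  have hN : (2 : ℝ) ≤ #𝒯 := by exact_mod_cast hc
  have hLN : 0 ≤ Real.log #𝒯 := Real.log_nonneg (by linarith)
  set m := ⌈2 * Real.log #𝒯 / α⌉₊ with hm
  have hm1 : 2 * Real.log #𝒯 ≤ α * m := by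
    rw [mul_comm α, ← div_le_iff₀ hα0]
    exact Nat.le_ceil _
  have hm2 : α * m ≤ 2 * Real.log #𝒯 + α := by
    have : (m : ℝ) < 2 * Real.log #𝒯 / α + 1 := Nat.ceil_lt_add_one (by positivity)
    calc α * m ≤ α * (2 * Real.log #𝒯 / α + 1) := by gcongr
      _ = _ := by field_simp
  obtain ⟨s, hs⟩ := exists_injOn_comp_of_separated 𝒯 hα hsep hc hm1
  have hcardim : #(𝒯.image fun g => g ∘ s) = #𝒯 := card_image_of_injOn hs
  have hvc' : HasVCBound ((𝒯.image fun g => g ∘ s : Finset (Fin m → Bool)) :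
      Set (Fin m → Bool)) ν := by
    rw [coe_image]
    exact hvc.comp s
  have key := log_card_le_of_hasVCBound hvc' (by omega) (x := α / 4) (by positivity) (by linarith)
  rw [hcardim, Fintype.card_fin, one_div_div] at key
  nlinarith

/-- A family of VC-dimension at most `ν` has nets at scale `4 ^ (-j)` whose logarithmic size is
linear in `ν` and in `j`. -/
theorem exists_net {ι : Type*} [Fintype ι] (𝒯 : Finset (ι → Bool)) {ν : ℕ} (hν : 1 ≤ ν)
    (hvc : HasVCBound (𝒯 : Set (ι → Bool)) ν) (j : ℕ) :
    ∃ 𝒩 : Finset (ι → Bool), (#𝒩 : ℝ) ≤ Real.exp (4 * ν * (j + 1)) ∧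
      ∀ h ∈ 𝒯, ∃ g ∈ 𝒩, (hammingDist g h : ℝ) ≤ (1 / 4) ^ j * Fintype.card ι := by
  classical
  set sep : Finset (ι → Bool) → Prop := fun 𝒩 =>
    ∀ g ∈ 𝒩, ∀ h ∈ 𝒩, g ≠ h → (1 / 4 : ℝ) ^ j * Fintype.card ι < hammingDist g h with hsepdef
  obtain ⟨𝒩, h𝒩, hmax⟩ := exists_max_image (𝒯.powerset.filter sep) card
    ⟨∅, mem_filter.2 ⟨empty_mem_powerset _, by simp [hsepdef]⟩⟩
  obtain ⟨hsub, hsep⟩ := mem_filter.1 h𝒩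
  rw [mem_powerset] at hsub
  refine ⟨𝒩, ?_, fun h hh => ?_⟩
  · rcases Nat.eq_zero_or_pos #𝒩 with h0 | h0
    · rw [h0]
      simpa using (Real.exp_pos _).le
    rw [← Real.log_le_iff_le_exp (by exact_mod_cast h0)]
    refine (log_card_le_of_separated 𝒩 (hvc.mono (by exact_mod_cast hsub)) (by positivity)
      (pow_le_one₀ (by norm_num) (by norm_num)) hsep).trans ?_
    have e : Real.log (4 / (1 / 4 : ℝ) ^ j) = 2 * (j + 1) * Real.log 2 := by
      have : (4 / (1 / 4 : ℝ) ^ j) = 2 ^ (2 * (j + 1)) := by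
        rw [pow_mul, pow_succ]
        norm_num
        rw [one_div, inv_pow, div_inv_eq_mul]
        ring
      rw [this, Real.log_pow]
      push_cast
      ring
    rw [e]
    have h2 := Real.log_two_lt_d9
    have hν' : (1 : ℝ) ≤ ν := by exact_mod_cast hν
    have hj : (0 : ℝ) ≤ j := by positivity
    have hp : 1 ≤ (ν : ℝ) * (j + 1) := by nlinarith
    nlinarith
  -- A maximal separated subfamily is a net: a member of `𝒯` far from all of it could be added.
  · by_contra! hcon
    have hnot : h ∉ 𝒩 := fun hm => by
      have := hcon h hm
      rw [hammingDist_self] at this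
      have h' : (0 : ℝ) ≤ (1 / 4) ^ j * Fintype.card ι := by positivity
      simp only [Nat.cast_zero] at this
      linarith
    have := hmax (insert h 𝒩) <| mem_filter.2
      ⟨mem_powerset.2 (insert_subset hh hsub), by
        intro a ha b hb hab
        rw [mem_insert] at ha hb
        rcases ha with rfl | ha <;> rcases hb with rfl | hb
        · exact absurd rfl hab
        · rw [hammingDist_comm]; exact hcon b hb
        · exact hcon a ha
        · exact hsep a ha b hb hab⟩
    rw [card_insert_of_notMem hnot] at this
    omega

end Packing

/-! ### Rademacher sums -/

section Signs

open Finset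

theorem card_filter_le_sum_of_one_le {ι : Type*} [Fintype ι] (p : ι → Prop) [DecidablePred p]
    (φ : ι → ℝ) (h0 : ∀ i, 0 ≤ φ i) (h1 : ∀ i, p i → 1 ≤ φ i) :
    (#(univ.filter p) : ℝ) ≤ ∑ i, φ i := by
  calc (#(univ.filter p) : ℝ) = ∑ i ∈ univ.filter p, (1 : ℝ) := by simp
    _ ≤ ∑ i ∈ univ.filter p, φ i := sum_le_sum fun i hi => h1 i (mem_filter.1 hi).2
    _ ≤ ∑ i, φ i := sum_le_sum_of_subset_of_nonneg (subset_univ _) fun i _ _ => h0 i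

/-- Hoeffding's inequality for Rademacher sums, as a count of sign vectors. -/
theorem card_sign_sum_gt_le {n : ℕ} (a : Fin n → ℝ) {V t : ℝ} (hV : 0 < V)
    (ha : ∑ i, a i ^ 2 ≤ V) (ht : 0 ≤ t) :
    (#(univ.filter fun σ : Fin n → Bool => t < ∑ i, if σ i then -a i else a i) : ℝ) ≤
      2 ^ n * Real.exp (-(t ^ 2 / (2 * V))) := by
  set l := t / V with hl
  have hl0 : 0 ≤ l := by positivity
  calc _ ≤ ∑ σ : Fin n → Bool, Real.exp (-(l * t) + ∑ i, l * if σ i then -a i else a i) := by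
        refine card_filter_le_sum_of_one_le _ _ (fun _ => (Real.exp_pos _).le) fun σ hσ => ?_
        rw [← mul_sum]
        refine Real.one_le_exp ?_
        have := mul_le_mul_of_nonneg_left hσ.le hl0
        linarith
    _ = Real.exp (-(l * t)) * ∏ i, ∑ b : Bool, Real.exp (l * if b then -a i else a i) := by
        rw [Fintype.prod_sum, mul_sum]
        refine sum_congr rfl fun σ _ => ?_
        rw [Real.exp_add, Real.exp_sum]
    _ ≤ Real.exp (-(l * t)) * ∏ i, (2 * Real.exp ((l * a i) ^ 2 / 2)) := by
        gcongr with i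
        have := Real.cosh_le_exp_half_sq (l * a i)
        rw [Real.cosh_eq] at this
        simp only [Fintype.sum_bool, if_true, Bool.false_eq_true, if_false, mul_neg]
        linarith
    _ = 2 ^ n * Real.exp (-(l * t) + l ^ 2 / 2 * ∑ i, a i ^ 2) := by
        rw [prod_mul_distrib, prod_const, card_univ, Fintype.card_fin, ← Real.exp_sum, Real.exp_add,
          mul_sum, mul_left_comm]
        congr 4
        funext i
        ring
    _ ≤ 2 ^ n * Real.exp (-(t ^ 2 / (2 * V))) := by
        gcongr
        have h1 : l ^ 2 / 2 * ∑ i, a i ^ 2 ≤ l ^ 2 / 2 * V := by gcongr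
        have h2 : -(l * t) + l ^ 2 / 2 * V = -(t ^ 2 / (2 * V)) := by rw [hl]; field_simp; ring
        linarith

/-- The signed difference `∑ i, ± (h (i, true) - h (i, false))`, a minus sign standing where `σ` is
true. If `h` is read off along a double sample, this is the number of hits in the second half minus
the number of hits in the first half, after the two members of the pair `i` have been exchanged
wherever `σ i` is true. -/
noncomputable def signedDiff {n : ℕ} (h : Fin n × Bool → Bool) (σ : Fin n → Bool) : ℝ :=
  ∑ i, if σ i then -((if h (i, true) then 1 else 0) - if h (i, false) then 1 else 0)
    else (if h (i, true) then 1 else 0) - if h (i, false) then 1 else 0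

theorem card_signedDiff_sub_gt_le {n : ℕ} (g h : Fin n × Bool → Bool) {D t : ℝ} (hD : 0 < D)
    (hgh : (hammingDist g h : ℝ) ≤ D) (ht : 0 ≤ t) :
    (#(univ.filter fun σ : Fin n → Bool => t < signedDiff h σ - signedDiff g σ) : ℝ) ≤
      2 ^ n * Real.exp (-(t ^ 2 / (4 * D))) := by
  set a : Fin n → ℝ := fun i =>
    ((if h (i, true) then 1 else 0) - if h (i, false) then 1 else 0) -
      ((if g (i, true) then 1 else 0) - if g (i, false) then 1 else 0) with ha
  have hsum : ∀ σ : Fin n → Bool, signedDiff h σ - signedDiff g σ =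
      ∑ i, if σ i then -a i else a i := by
    intro σ
    rw [signedDiff, signedDiff, ← sum_sub_distrib]
    refine sum_congr rfl fun i _ => ?_
    simp only [ha]
    split_ifs <;> ring
  have hham : (hammingDist g h : ℝ) =
      ∑ i, ∑ b : Bool, if g (i, b) ≠ h (i, b) then (1 : ℝ) else 0 := by
    rw [hammingDist, card_filter, ← Fintype.sum_prod_type']
    push_cast
    rfl
  have hV : ∑ i, a i ^ 2 ≤ 2 * D := by
    refine le_trans ?_ (mul_le_mul_of_nonneg_left hgh two_pos.le)
    rw [hham, mul_sum]
    refine sum_le_sum fun i _ => ?_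
    simp only [ha, Fintype.sum_bool]
    cases g (i, true) <;> cases g (i, false) <;> cases h (i, true) <;> cases h (i, false) <;>
      norm_num
  simp only [hsum]
  refine (card_sign_sum_gt_le a (by positivity) hV ht).trans_eq ?_
  ring_nf

end Signs

/-! ### Chaining -/

section Chaining

open Finset

theorem geom_sum_le_inv_one_sub {r : ℝ} (h0 : 0 ≤ r) (h1 : r < 1) (J : ℕ) :
    ∑ j ∈ range J, r ^ j ≤ (1 - r)⁻¹ := by
  rw [← one_div, le_div_iff₀ (by linarith), geom_sum_mul_neg]
  linarith [pow_nonneg h0 J]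

/-- The union bound over one link of the chain: the nets at levels `j` and `j + 1` have together at
most `exp (12 ν (j + 1))` pairs, while the increment threshold `(3 / 4) ^ j` decays more slowly
than the standard deviation `2 ^ (-j)`, so that Hoeffding's exponent grows at least linearly
in `j`. -/
theorem exists_small_forall_increment_le {n : ℕ} (hn : 0 < n) {ν : ℕ} {ε δ : ℝ} (hε : 0 < ε)
    (hδ : 0 < δ) (hnε : 1024 * (12 * ν + Real.log (8 / δ)) ≤ n * ε ^ 2) (j : ℕ)
    (𝒩 𝒩' : Finset (Fin n × Bool → Bool)) (h𝒩 : (#𝒩 : ℝ) ≤ Real.exp (4 * ν * (j + 1)))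
    (h𝒩' : (#𝒩' : ℝ) ≤ Real.exp (4 * ν * ((j + 1 : ℕ) + 1))) :
    ∃ E : Finset (Fin n → Bool), (#E : ℝ) ≤ 2 ^ n * (δ / 8) ^ (j + 1) ∧
      ∀ σ ∉ E, ∀ g ∈ 𝒩, ∀ h ∈ 𝒩', (hammingDist g h : ℝ) ≤ 4 * n * (1 / 4) ^ j →
        signedDiff h σ - signedDiff g σ ≤ n * ε / 8 * (3 / 4) ^ j := by
  classical
  have hn' : (0 : ℝ) < n := by exact_mod_cast hn
  set D : ℝ := 4 * n * (1 / 4) ^ j with hDdef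
  set t : ℝ := n * ε / 8 * (3 / 4) ^ j with htdef
  have hD : 0 < D := by positivity
  have ht : 0 ≤ t := by positivity
  set pairs := (𝒩 ×ˢ 𝒩').filter fun p => (hammingDist p.1 p.2 : ℝ) ≤ D with hpairs
  have hexp : t ^ 2 / (4 * D) = n * ε ^ 2 / 1024 * (9 / 4) ^ j := by
    have e : ((3 / 4 : ℝ) ^ j) ^ 2 = (9 / 4) ^ j * (1 / 4) ^ j := by
      rw [← mul_pow, ← pow_mul, mul_comm j 2, pow_mul]
      norm_num
    rw [htdef, hDdef, mul_pow, e]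
    field_simp
    ring
  have hgrow : (j + 1 : ℝ) ≤ (9 / 4) ^ j := by
    have := one_add_mul_le_pow (show (-2 : ℝ) ≤ 5 / 4 by norm_num) j
    have hj : (0 : ℝ) ≤ j := by positivity
    norm_num at this ⊢
    linarith
  have hfin : 4 * ν * (j + 1) + 4 * ν * ((j + 1 : ℕ) + 1 : ℝ) + -(t ^ 2 / (4 * D)) ≤
      ((j + 1 : ℕ) : ℝ) * Real.log (δ / 8) := by
    have h1 : (12 * ν + Real.log (8 / δ)) * (j + 1) ≤ n * ε ^ 2 / 1024 * (9 / 4) ^ j :=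
      calc (12 * ν + Real.log (8 / δ)) * (j + 1) ≤ n * ε ^ 2 / 1024 * (j + 1) := by
            gcongr
            linarith
        _ ≤ _ := by gcongr
    have h2 : Real.log (δ / 8) = -Real.log (8 / δ) := by
      rw [← Real.log_inv, inv_div]
    have h3 : (0 : ℝ) ≤ ν * j := by positivity
    rw [hexp, h2]
    push_cast
    nlinarith
  refine ⟨pairs.biUnion fun p => univ.filter fun σ => t < signedDiff p.2 σ - signedDiff p.1 σ,
    ?_, fun σ hσ g hg h hh hd => ?_⟩
  swap
  · by_contra! hlt
    exact hσ (mem_biUnion.2 ⟨(g, h), mem_filter.2 ⟨mem_product.2 ⟨hg, hh⟩, hd⟩,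
      mem_filter.2 ⟨mem_univ _, hlt⟩⟩)
  calc _ ≤ ((∑ p ∈ pairs, #(univ.filter fun σ : Fin n → Bool =>
          t < signedDiff p.2 σ - signedDiff p.1 σ) : ℕ) : ℝ) := by
        exact_mod_cast card_biUnion_le
    _ ≤ ∑ p ∈ pairs, 2 ^ n * Real.exp (-(t ^ 2 / (4 * D))) := by
        push_cast
        exact sum_le_sum fun p hp => card_signedDiff_sub_gt_le p.1 p.2 hD (mem_filter.1 hp).2 ht
    _ = #pairs * (2 ^ n * Real.exp (-(t ^ 2 / (4 * D)))) := by simp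
    _ ≤ (Real.exp (4 * ν * (j + 1)) * Real.exp (4 * ν * ((j + 1 : ℕ) + 1))) *
          (2 ^ n * Real.exp (-(t ^ 2 / (4 * D)))) := by
        gcongr
        calc (#pairs : ℝ) ≤ (#(𝒩 ×ˢ 𝒩') : ℕ) := by exact_mod_cast card_filter_le _ _
          _ = #𝒩 * #𝒩' := by rw [card_product]; push_cast; rfl
          _ ≤ _ := by gcongr
    _ = 2 ^ n * Real.exp (4 * ν * (j + 1) + 4 * ν * ((j + 1 : ℕ) + 1 : ℝ) +
          -(t ^ 2 / (4 * D))) := by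
        rw [Real.exp_add, Real.exp_add]
        ring
    _ ≤ 2 ^ n * Real.exp (((j + 1 : ℕ) : ℝ) * Real.log (δ / 8)) := by gcongr
    _ = 2 ^ n * (δ / 8) ^ (j + 1) := by
        rw [Real.exp_nat_mul, Real.exp_log (by positivity)]

/-- The chaining bound. For a fixed double sample, all but few exchanges of its pairs make the two
halves differ by at most `n ε / 2` on every member of the family. Starting each chain at the empty
set makes the first link an ordinary increment. -/
theorem exists_small_forall_signedDiff_le {n : ℕ} (hn : 0 < n) {ν : ℕ} (hν : 1 ≤ ν) {ε δ : ℝ}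
    (hε : 0 < ε) (hδ : 0 < δ) (hδ1 : δ < 1)
    (hnε : 1024 * (12 * ν + Real.log (8 / δ)) ≤ n * ε ^ 2)
    (𝒯 : Finset (Fin n × Bool → Bool)) (hvc : HasVCBound (𝒯 : Set (Fin n × Bool → Bool)) ν) :
    ∃ E : Finset (Fin n → Bool), (#E : ℝ) ≤ 2 ^ n * (δ / 4) ∧
      ∀ σ ∉ E, ∀ h ∈ 𝒯, signedDiff h σ ≤ n * ε / 2 := by
  classical
  have hn' : (0 : ℝ) < n := by exact_mod_cast hn
  have hcardι : (Fintype.card (Fin n × Bool) : ℝ) = 2 * n := by simp [mul_comm]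
  have hnets : ∀ j : ℕ, ∃ 𝒩 : Finset (Fin n × Bool → Bool),
      (#𝒩 : ℝ) ≤ Real.exp (4 * ν * (j + 1)) ∧ ∀ h ∈ 𝒯, ∃ g ∈ 𝒩,
        (hammingDist g h : ℝ) ≤ (1 / 4) ^ j * (2 * n) ∧ (j = 0 → g = fun _ => false) := by
    intro j
    rcases Nat.eq_zero_or_pos j with rfl | hj
    · refine ⟨{fun _ => false}, ?_, fun h _ => ⟨_, mem_singleton_self _, ?_, fun _ => rfl⟩⟩
      · rw [card_singleton, Nat.cast_one]
        exact Real.one_le_exp (by positivity)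
      · rw [pow_zero, one_mul, ← hcardι]
        exact_mod_cast hammingDist_le_card_fintype
    · obtain ⟨𝒩, h1, h2⟩ := exists_net 𝒯 hν hvc j
      refine ⟨𝒩, h1, fun h hh => ?_⟩
      obtain ⟨g, hg, hd⟩ := h2 h hh
      exact ⟨g, hg, by rwa [hcardι] at hd, fun h0 => by omega⟩
  choose 𝒩 hcard π hπ𝒩 hπd hπ0 using hnets
  -- At this level the net distance is below `1`, so the chain has reached `h` itself.
  obtain ⟨J, hJ⟩ := exists_pow_lt_of_lt_one (show (0 : ℝ) < 1 / (2 * n) by positivity)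
    (show (1 / 4 : ℝ) < 1 by norm_num)
  have hπJ : ∀ h hh, π J h hh = h := by
    intro h hh
    have h1 := hπd J h hh
    have h2 : (1 / 4 : ℝ) ^ J * (2 * n) < 1 := by
      rwa [lt_div_iff₀ (by positivity)] at hJ
    have h3 : hammingDist (π J h hh) h < 1 := by exact_mod_cast h1.trans_lt h2
    exact hammingDist_lt_one.1 h3
  choose E hEcard hE using fun j =>
    exists_small_forall_increment_le hn hε hδ hnε j (𝒩 j) (𝒩 (j + 1)) (hcard j) (hcard (j + 1))
  refine ⟨(range J).biUnion E, ?_, fun σ hσ h hh => ?_⟩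
  swap
  · have hstep : ∀ j ∈ range J, signedDiff (π (j + 1) h hh) σ - signedDiff (π j h hh) σ ≤
        n * ε / 8 * (3 / 4) ^ j := by
      intro j hj
      have h1 := hπd j h hh
      have h2 := hπd (j + 1) h hh
      have h3 : (hammingDist (π j h hh) (π (j + 1) h hh) : ℝ) ≤
          hammingDist (π j h hh) h + hammingDist (π (j + 1) h hh) h := by
        have := hammingDist_triangle_right (π j h hh) (π (j + 1) h hh) h
        exact_mod_cast this
      have h4 : (1 / 4 : ℝ) ^ (j + 1) * (2 * n) ≤ (1 / 4) ^ j * (2 * n) :=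
        mul_le_mul_of_nonneg_right
          (pow_le_pow_of_le_one (by norm_num) (by norm_num) (Nat.le_succ j)) (by positivity)
      have hd : (hammingDist (π j h hh) (π (j + 1) h hh) : ℝ) ≤ 4 * n * (1 / 4) ^ j := by
        linarith only [h1, h2, h3, h4]
      exact hE j σ (fun hσE => hσ (mem_biUnion.2 ⟨j, hj, hσE⟩)) _ (hπ𝒩 j h hh) _
        (hπ𝒩 (j + 1) h hh) hd
    have htel := sum_le_sum hstep
    rw [sum_range_sub (fun j => signedDiff (π j h hh) σ), hπJ, hπ0 0 h hh rfl, ← mul_sum] at htel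
    have hzero : signedDiff (fun _ : Fin n × Bool => false) σ = 0 := by simp [signedDiff]
    have hgeom : ∑ j ∈ range J, (3 / 4 : ℝ) ^ j ≤ 4 :=
      (geom_sum_le_inv_one_sub (by norm_num) (by norm_num) J).trans_eq (by norm_num)
    have h5 : n * ε / 8 * ∑ j ∈ range J, (3 / 4 : ℝ) ^ j ≤ n * ε / 8 * 4 := by gcongr
    rw [hzero] at htel
    linarith
  calc _ ≤ ((∑ j ∈ range J, #(E j) : ℕ) : ℝ) := by
        exact_mod_cast card_biUnion_le
    _ ≤ ∑ j ∈ range J, 2 ^ n * (δ / 8) ^ (j + 1) := by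
        rw [Nat.cast_sum]
        exact sum_le_sum fun j _ => hEcard j
    _ = 2 ^ n * (δ / 8 * ∑ j ∈ range J, (δ / 8) ^ j) := by
        rw [mul_sum, mul_sum]
        refine sum_congr rfl fun j _ => ?_
        ring
    _ ≤ 2 ^ n * (δ / 8 * 2) := by
        gcongr
        refine (geom_sum_le_inv_one_sub (by positivity) (by linarith) J).trans ?_
        exact inv_le_of_inv_le₀ two_pos (by linarith)
    _ = 2 ^ n * (δ / 4) := by ring

end Chaining

/-! ### Symmetrization with a second sample -/

section GhostSample

open Finset

/-- The number of indices at which `f` is true, as a real number. -/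
noncomputable def trueCount {ι : Type*} [Fintype ι] (f : ι → Bool) : ℝ :=
  ∑ i, if f i then 1 else 0

theorem trueCount_le_card {ι : Type*} [Fintype ι] (f : ι → Bool) :
    trueCount f ≤ Fintype.card ι := by
  calc trueCount f ≤ ∑ _i : ι, (1 : ℝ) := sum_le_sum fun i _ => by split_ifs <;> norm_num
    _ = Fintype.card ι := by simp

theorem exp_neg_le_quadratic {l : ℝ} (hl : 0 ≤ l) : Real.exp (-l) ≤ 1 - l + l ^ 2 / 2 := by
  have h1 := Real.quadratic_le_exp_of_nonneg hl
  have h2 : 0 < 1 - l + l ^ 2 / 2 := by nlinarith [sq_nonneg (l - 1)]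
  rw [Real.exp_neg, inv_le_iff_one_le_mul₀ (Real.exp_pos l)]
  -- `(1 - l + l² / 2) (1 + l + l² / 2) = 1 + l⁴ / 4`
  calc (1 : ℝ) ≤ (1 - l + l ^ 2 / 2) * (1 + l + l ^ 2 / 2) := by nlinarith [sq_nonneg (l ^ 2)]
    _ ≤ _ := by gcongr

/-- The Chernoff bound for the lower tail of the number of hits of `h` in `n` independent uniform
draws, as a count of samples. -/
theorem card_trueCount_comp_le {X : Type*} [Fintype X] [Nonempty X] (h : X → Bool) (n : ℕ)
    {l : ℝ} (hl : 0 ≤ l) (s : ℝ) :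
    (#(univ.filter fun S : Fin n → X =>
        trueCount (h ∘ S) ≤ n * (trueCount h / Fintype.card X) - s) : ℝ) ≤
      (Fintype.card X : ℝ) ^ n *
        Real.exp (n * (trueCount h / Fintype.card X) * (l ^ 2 / 2) - l * s) := by
  set N : ℝ := (Fintype.card X : ℝ) with hN
  have hN0 : 0 < N := by rw [hN]; exact_mod_cast Fintype.card_pos
  set p := trueCount h / N with hp
  have hmgf : ∑ x, Real.exp (-(l * if h x then 1 else 0)) ≤
      N * Real.exp ((-l + l ^ 2 / 2) * p) := by
    calc ∑ x, Real.exp (-(l * if h x then 1 else 0))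
        ≤ ∑ x, (1 + (-l + l ^ 2 / 2) * if h x then 1 else 0) := by
          refine sum_le_sum fun x _ => ?_
          have := exp_neg_le_quadratic hl
          split_ifs
          · rw [mul_one]; linarith
          · simp
      _ = N * (1 + (-l + l ^ 2 / 2) * p) := by
          rw [sum_add_distrib, ← mul_sum, hp, trueCount]
          simp only [sum_const, card_univ, nsmul_eq_mul, mul_one]
          rw [← hN]
          field_simp
      _ ≤ _ := by
          gcongr
          have := Real.add_one_le_exp ((-l + l ^ 2 / 2) * p)
          linarith
  calc _ ≤ ∑ S : Fin n → X, Real.exp (l * (n * p - s)) *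
          ∏ i, Real.exp (-(l * if h (S i) then 1 else 0)) := by
        refine card_filter_le_sum_of_one_le _ _ (fun _ => by positivity) fun S hS => ?_
        rw [← Real.exp_sum, ← Real.exp_add, sum_neg_distrib, ← mul_sum]
        refine Real.one_le_exp ?_
        have := mul_le_mul_of_nonneg_left hS hl
        simp only [trueCount, Function.comp_apply] at this
        linarith
    _ = Real.exp (l * (n * p - s)) * (∑ x, Real.exp (-(l * if h x then 1 else 0))) ^ n := by
        rw [← mul_sum, ← Fintype.prod_sum fun (_ : Fin n) x =>
          Real.exp (-(l * if h x then 1 else 0)), prod_const, card_univ, Fintype.card_fin]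
    _ ≤ Real.exp (l * (n * p - s)) * (N * Real.exp ((-l + l ^ 2 / 2) * p)) ^ n := by
        gcongr
    _ = N ^ n * Real.exp (n * p * (l ^ 2 / 2) - l * s) := by
        rw [mul_pow, ← Real.exp_nat_mul, mul_left_comm, ← Real.exp_add]
        ring_nf

/-- The double sample whose pair `i` consists of `S i` and `S' i`. -/
def joinSamples {n : ℕ} {X : Type*} (S S' : Fin n → X) : Fin n × Bool → X :=
  fun p => if p.2 then S' p.1 else S p.1

/-- Exchanges the two members of the pair `i` wherever `σ i` is true. -/
def swapPairs {n : ℕ} {X : Type*} (σ : Fin n → Bool) (w : Fin n × Bool → X) : Fin n × Bool → X :=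
  fun p => w (p.1, p.2 ^^ σ p.1)

theorem swapPairs_involutive {n : ℕ} {X : Type*} (σ : Fin n → Bool) :
    Function.Involutive (swapPairs (X := X) σ) := fun w => by
  funext ⟨i, b⟩
  simp [swapPairs]

/-- Splitting a double sample into its two halves. -/
def joinSamplesEquiv (n : ℕ) (X : Type*) :
    ((Fin n → X) × (Fin n → X)) ≃ (Fin n × Bool → X) where
  toFun p := joinSamples p.1 p.2
  invFun w := (fun i => w (i, false), fun i => w (i, true))
  left_inv p := by simp [joinSamples]
  right_inv w := by
    funext ⟨i, b⟩
    cases b <;> simp [joinSamples]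

open Classical in
/-- Symmetrization. If every sample in `bad` is completed by at least half of all second samples to
a double sample with property `B`, and if every double sample has property `B` for at most a
fraction `q` of all exchanges of its pairs, then at most a fraction `2 q` of all samples is
in `bad`. -/
theorem card_le_of_swapPairs {n : ℕ} {X : Type*} [Fintype X] [Nonempty X]
    (bad : Finset (Fin n → X)) (B : (Fin n × Bool → X) → Prop) {q : ℝ}
    (hghost : ∀ S ∈ bad, (Fintype.card X : ℝ) ^ n / 2 ≤
      #(univ.filter fun S' : Fin n → X => B (joinSamples S S')))
    (hswap : ∀ w : Fin n × Bool → X, ∃ E : Finset (Fin n → Bool), (#E : ℝ) ≤ 2 ^ n * q ∧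
      ∀ σ ∉ E, ¬ B (swapPairs σ w)) :
    (#bad : ℝ) ≤ (Fintype.card X : ℝ) ^ n * (2 * q) := by
  set N : ℝ := (Fintype.card X : ℝ) with hN
  have hN0 : 0 < N := by rw [hN]; exact_mod_cast Fintype.card_pos
  set f : (Fin n × Bool → X) → ℝ := fun w => if B w then 1 else 0 with hf
  have hf0 : ∀ w, 0 ≤ f w := fun w => by simp only [hf]; split_ifs <;> norm_num
  have hlow : #bad * (N ^ n / 2) ≤ ∑ w, f w := by
    rw [← (joinSamplesEquiv n X).sum_comp, Fintype.sum_prod_type]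
    calc #bad * (N ^ n / 2) = ∑ S ∈ bad, N ^ n / 2 := by simp
      _ ≤ ∑ S ∈ bad, ∑ S', f (joinSamples S S') := by
        refine sum_le_sum fun S hS => (hghost S hS).trans_eq ?_
        simp [hf]
      _ ≤ ∑ S, ∑ S', f (joinSamples S S') :=
        sum_le_sum_of_subset_of_nonneg (subset_univ _) fun S _ _ => sum_nonneg fun S' _ => hf0 _
  have hup : 2 ^ n * ∑ w, f w ≤ N ^ n * N ^ n * (2 ^ n * q) := by
    calc 2 ^ n * ∑ w, f w = ∑ _σ : Fin n → Bool, ∑ w, f w := by simp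
      _ = ∑ σ : Fin n → Bool, ∑ w, f (swapPairs σ w) :=
        sum_congr rfl fun σ _ => (Equiv.sum_comp (swapPairs_involutive σ).toPerm f).symm
      _ = ∑ w, ∑ σ : Fin n → Bool, f (swapPairs σ w) := sum_comm
      _ ≤ ∑ _w : Fin n × Bool → X, 2 ^ n * q := by
        refine sum_le_sum fun w _ => ?_
        obtain ⟨E, hE, hBE⟩ := hswap w
        refine le_trans ?_ hE
        simp only [hf, sum_boole, Nat.cast_le]
        refine card_le_card fun σ hσ => ?_
        by_contra hσE
        exact hBE σ hσE (mem_filter.1 hσ).2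
      _ = N ^ n * N ^ n * (2 ^ n * q) := by
        simp only [sum_const, card_univ, Fintype.card_fun, Fintype.card_prod, Fintype.card_fin,
          Fintype.card_bool, nsmul_eq_mul, hN]
        push_cast
        rw [← pow_add, mul_two]
  have h2 : (0 : ℝ) < 2 ^ n := by positivity
  have h3 : ∑ w, f w ≤ N ^ n * N ^ n * q := by
    refine le_of_mul_le_mul_left (hup.trans_eq ?_) h2
    ring
  refine le_of_mul_le_mul_right ((hlow.trans h3).trans_eq ?_) (show 0 < N ^ n / 2 by positivity)
  ring

open Classical in
/-- At least half of all second samples satisfy `P` if `P` can fail only where the number of hits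
of `h` is in a lower tail of Chernoff exponent at least `1`. -/
theorem half_le_card_of_lower_tail {X : Type*} [Fintype X] [Nonempty X] (h : X → Bool) {n : ℕ}
    {l s : ℝ} (hl : 0 ≤ l)
    (hexp : n * (trueCount h / Fintype.card X) * (l ^ 2 / 2) - l * s ≤ -1)
    (P : (Fin n → X) → Prop)
    (hP : ∀ S, n * (trueCount h / Fintype.card X) - s < trueCount (h ∘ S) → P S) :
    (Fintype.card X : ℝ) ^ n / 2 ≤ #(univ.filter P) := by
  have h1 := card_trueCount_comp_le h n hl s
  have h2 : Real.exp (n * (trueCount h / Fintype.card X) * (l ^ 2 / 2) - l * s) ≤ 1 / 2 := by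
    refine (Real.exp_le_exp.2 hexp).trans ?_
    rw [Real.exp_neg, one_div]
    exact inv_anti₀ two_pos (by linarith [Real.add_one_le_exp 1])
  have h3 : #(univ.filter fun S : Fin n → X => ¬ P S) ≤ #(univ.filter fun S : Fin n → X =>
      trueCount (h ∘ S) ≤ n * (trueCount h / Fintype.card X) - s) :=
    card_le_card fun S hS => mem_filter.2 ⟨mem_univ _, by
      by_contra! hlt
      exact (mem_filter.1 hS).2 (hP S hlt)⟩
  have h4 : #(univ.filter P) + #(univ.filter fun S : Fin n → X => ¬ P S) =
      Fintype.card X ^ n := by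
    rw [card_filter_add_card_filter_not]
    simp
  have h5 : (#(univ.filter P) : ℝ) + #(univ.filter fun S : Fin n → X => ¬ P S) =
      (Fintype.card X : ℝ) ^ n := by exact_mod_cast h4
  have h6 : (#(univ.filter fun S : Fin n → X => ¬ P S) : ℝ) ≤ (Fintype.card X : ℝ) ^ n * (1 / 2) :=
    calc _ ≤ (#(univ.filter fun S : Fin n → X =>
          trueCount (h ∘ S) ≤ n * (trueCount h / Fintype.card X) - s) : ℝ) := by exact_mod_cast h3
      _ ≤ _ := h1
      _ ≤ _ := by gcongr
  linarith

end GhostSample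

/-! ### Bad samples of a class of bounded VC-dimension -/

section UniformDeviation

open Finset

theorem exists_trace {ι X : Type*} [Finite ι] {𝓗 : Set (X → Bool)} {ν : ℕ}
    (hvc : HasVCBound 𝓗 ν) (w : ι → X) :
    ∃ 𝒯 : Finset (ι → Bool), HasVCBound (𝒯 : Set (ι → Bool)) ν ∧
      ∀ h ∈ 𝓗, h ∘ w ∈ 𝒯 := by
  have hfin : ((fun h : X → Bool => h ∘ w) '' 𝓗).Finite := Set.toFinite _
  refine ⟨hfin.toFinset, ?_, fun h hh => hfin.mem_toFinset.2 ⟨h, hh, rfl⟩⟩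
  rw [hfin.coe_toFinset]
  exact hvc.comp w

theorem signedDiff_comp {n : ℕ} {X : Type*} (h : X → Bool) (w : Fin n × Bool → X)
    (σ : Fin n → Bool) :
    signedDiff (h ∘ w) σ = trueCount (fun i => h (swapPairs σ w (i, true))) -
      trueCount (fun i => h (swapPairs σ w (i, false))) := by
  rw [trueCount, trueCount, signedDiff, ← sum_sub_distrib]
  refine sum_congr rfl fun i _ => ?_
  cases hσ : σ i <;> simp [swapPairs, hσ]

/-- Uniform convergence: outside a fraction `δ / 2` of the samples, no member of the class has
frequency more than `ε` below its true mean. -/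
theorem exists_small_forall_mean_le {X : Type*} [Fintype X] [Nonempty X]
    {𝓗 : Set (X → Bool)} {ν : ℕ}
    (hν : 1 ≤ ν) (hvc : HasVCBound 𝓗 ν) {n : ℕ} (hn : 0 < n) {ε δ : ℝ} (hε : 0 < ε) (hδ : 0 < δ)
    (hδ1 : δ < 1) (hnε : 1024 * (12 * ν + Real.log (8 / δ)) ≤ n * ε ^ 2) :
    ∃ bad : Finset (Fin n → X), (#bad : ℝ) ≤ (Fintype.card X : ℝ) ^ n * (δ / 2) ∧
      ∀ S ∉ bad, ∀ h ∈ 𝓗, trueCount h / Fintype.card X ≤ trueCount (h ∘ S) / n + ε := by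
  classical
  have hn' : (0 : ℝ) < n := by exact_mod_cast hn
  have key := card_le_of_swapPairs (q := δ / 4)
    (univ.filter fun S : Fin n → X => ∃ h ∈ 𝓗,
        trueCount (h ∘ S) / n + ε < trueCount h / Fintype.card X)
    (fun w => ∃ h ∈ 𝓗, n * ε / 2 <
      trueCount (fun i => h (w (i, true))) - trueCount (fun i => h (w (i, false))))
    (fun S hS => ?_) (fun w => ?_)
  · refine ⟨_, key.trans_eq (by ring), fun S hS h hh => ?_⟩
    by_contra! hlt
    exact hS (mem_filter.2 ⟨mem_univ _, h, hh, hlt⟩)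
  · obtain ⟨h, hh, hdev⟩ := (mem_filter.1 hS).2
    refine half_le_card_of_lower_tail h (l := ε / 2) (s := n * ε / 2) (by positivity) ?_ _
      fun S' hS' => ⟨h, hh, ?_⟩
    · have hp : trueCount h / Fintype.card X ≤ 1 :=
        div_le_one_of_le₀ (trueCount_le_card h) (by positivity)
      have hlog : 0 ≤ Real.log (8 / δ) :=
        Real.log_nonneg (by rw [le_div_iff₀ hδ]; linarith)
      have hν' : (1 : ℝ) ≤ ν := by exact_mod_cast hν
      have h1 : n * (trueCount h / Fintype.card X) * ((ε / 2) ^ 2 / 2) ≤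
          n * 1 * ((ε / 2) ^ 2 / 2) := by gcongr
      nlinarith
    · have h1 : trueCount (h ∘ S) + n * ε < n * (trueCount h / Fintype.card X) := by
        have := mul_lt_mul_of_pos_left hdev hn'
        rwa [mul_add, mul_div_cancel₀ _ hn'.ne'] at this
      simp only [joinSamples, if_true, Bool.false_eq_true, if_false]
      simp only [Function.comp_def] at h1 hS'
      linarith
  · obtain ⟨𝒯, hvc𝒯, hmem⟩ := exists_trace hvc w
    obtain ⟨E, hE, hle⟩ := exists_small_forall_signedDiff_le hn hν hε hδ hδ1 hnε 𝒯 hvc𝒯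
    refine ⟨E, hE, fun σ hσ ⟨h, hh, hlt⟩ => ?_⟩
    have := hle σ hσ _ (hmem h hh)
    rw [signedDiff_comp] at this
    linarith

/-- At most one in `2 ^ s` exchanges leaves no hit of `T` in the first half and at least `s` hits in
the second. Each such exchange is weighted by `2` to the power of the number of these hits: a pair
with one hit admits one choice of weight `2`, a pair without hits two choices of weight `1`. -/
theorem card_swap_hits_le {n : ℕ} (T : Fin n × Bool → Bool) (s : ℝ) :
    (#(univ.filter fun σ : Fin n → Bool => (∀ i, T (i, σ i) = false) ∧
        s ≤ trueCount fun i => T (i, !σ i)) : ℝ) ≤ 2 ^ n * Real.exp (-(Real.log 2 * s)) := by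
  calc _ ≤ ∑ σ : Fin n → Bool, Real.exp (-(Real.log 2 * s)) *
          ∏ i, (if T (i, σ i) then 0 else if T (i, !σ i) then 2 else 1 : ℝ) := by
        refine card_filter_le_sum_of_one_le _ _ (fun σ => mul_nonneg (Real.exp_pos _).le
          (prod_nonneg fun i _ => by split_ifs <;> norm_num)) fun σ hσ => ?_
        have : ∏ i, (if T (i, σ i) then 0 else if T (i, !σ i) then 2 else 1 : ℝ) =
            Real.exp (Real.log 2 * trueCount fun i => T (i, !σ i)) := by
          rw [trueCount, mul_sum, Real.exp_sum]
          refine prod_congr rfl fun i _ => ?_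
          rw [hσ.1 i]
          cases T (i, !σ i) <;> simp [Real.exp_log]
        rw [this, ← Real.exp_add]
        refine Real.one_le_exp ?_
        have := mul_le_mul_of_nonneg_left hσ.2 (Real.log_nonneg one_le_two)
        linarith
    _ = Real.exp (-(Real.log 2 * s)) *
          ∏ i, ∑ b : Bool, (if T (i, b) then 0 else if T (i, !b) then 2 else 1 : ℝ) := by
        rw [Fintype.prod_sum, mul_sum]
    _ ≤ Real.exp (-(Real.log 2 * s)) * ∏ _i : Fin n, (2 : ℝ) := by
        gcongr with i
        simp only [Fintype.sum_bool, Bool.not_true, Bool.not_false]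
        cases T (i, true) <;> cases T (i, false) <;> norm_num
    _ = _ := by simp [mul_comm]

/-- The `ε`-net theorem: outside a fraction `δ / 2` of the samples, every member of the class that
misses the sample entirely has mean at most `ε`. -/
theorem exists_small_forall_missed_mean_le {X : Type*} [Fintype X] [Nonempty X]
    {𝓗 : Set (X → Bool)} {ν : ℕ}
    (hvc : HasVCBound 𝓗 ν) {n : ℕ} {ε δ : ℝ} (hε : 0 < ε) (hε1 : ε < 1) (hδ : 0 < δ)
    (hnε : 8 * (ν * Real.log (16 / ε) + Real.log (4 / δ)) ≤ n * ε) (hnε8 : 8 ≤ n * ε) :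
    ∃ bad : Finset (Fin n → X), (#bad : ℝ) ≤ (Fintype.card X : ℝ) ^ n * (δ / 2) ∧
      ∀ S ∉ bad, ∀ h ∈ 𝓗, (∀ i, h (S i) = false) → trueCount h / Fintype.card X ≤ ε := by
  classical
  have key := card_le_of_swapPairs (q := δ / 4)
    (univ.filter fun S : Fin n → X => ∃ h ∈ 𝓗, (∀ i, h (S i) = false) ∧
        ε < trueCount h / Fintype.card X)
    (fun w => ∃ h ∈ 𝓗, (∀ i, h (w (i, false)) = false) ∧
      n * ε / 2 ≤ trueCount fun i => h (w (i, true)))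
    (fun S hS => ?_) (fun w => ?_)
  · refine ⟨_, key.trans_eq (by ring), fun S hS h hh hmiss => ?_⟩
    by_contra! hlt
    exact hS (mem_filter.2 ⟨mem_univ _, h, hh, hmiss, hlt⟩)
  · obtain ⟨h, hh, hmiss, hp⟩ := (mem_filter.1 hS).2
    have h1 : n * ε ≤ n * (trueCount h / Fintype.card X) := by gcongr
    refine half_le_card_of_lower_tail h (l := 1 / 2)
      (s := n * (trueCount h / Fintype.card X) / 2) (by norm_num) (by linarith) _
      fun S' hS' => ⟨h, hh, ?_, ?_⟩
    · simpa [joinSamples] using hmiss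
    · simp only [joinSamples, if_true]
      simp only [Function.comp_def] at hS'
      linarith
  · obtain ⟨𝒯, hvc𝒯, hmem⟩ := exists_trace hvc w
    have hcard : (#𝒯 : ℝ) ≤ Real.exp (ν * Real.log (16 / ε) + n * ε / 8) := by
      rcases Nat.eq_zero_or_pos #𝒯 with h0 | h0
      · rw [h0]
        simpa using (Real.exp_pos _).le
      rw [← Real.log_le_iff_le_exp (by exact_mod_cast h0)]
      refine (log_card_le_of_hasVCBound hvc𝒯 h0 (x := ε / 16) (by positivity)
        (by linarith)).trans_eq ?_
      simp only [one_div_div, Fintype.card_prod, Fintype.card_fin, Fintype.card_bool]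
      push_cast
      ring
    refine ⟨𝒯.biUnion fun T => univ.filter fun σ : Fin n → Bool => (∀ i, T (i, σ i) = false) ∧
      n * ε / 2 ≤ trueCount fun i => T (i, !σ i), ?_, fun σ hσ ⟨h, hh, hB⟩ => hσ ?_⟩
    swap
    · exact mem_biUnion.2 ⟨_, hmem h hh, mem_filter.2 ⟨mem_univ _, by
        simpa [swapPairs] using hB⟩⟩
    calc _ ≤ ((∑ T ∈ 𝒯, #(univ.filter fun σ : Fin n → Bool => (∀ i, T (i, σ i) = false) ∧
          n * ε / 2 ≤ trueCount fun i => T (i, !σ i)) : ℕ) : ℝ) := by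
          exact_mod_cast card_biUnion_le
      _ ≤ ∑ T ∈ 𝒯, 2 ^ n * Real.exp (-(Real.log 2 * (n * ε / 2))) := by
          rw [Nat.cast_sum]
          exact sum_le_sum fun T _ => card_swap_hits_le T _
      _ = #𝒯 * (2 ^ n * Real.exp (-(Real.log 2 * (n * ε / 2)))) := by simp
      _ ≤ Real.exp (ν * Real.log (16 / ε) + n * ε / 8) *
            (2 ^ n * Real.exp (-(Real.log 2 * (n * ε / 2)))) := by gcongr
      _ = 2 ^ n * Real.exp (ν * Real.log (16 / ε) + n * ε / 8 +
            -(Real.log 2 * (n * ε / 2))) := by rw [Real.exp_add _ (-_)]; ring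
      _ ≤ 2 ^ n * Real.exp (Real.log (δ / 4)) := by
          gcongr
          have h1 : Real.log (δ / 4) = -Real.log (4 / δ) := by rw [← Real.log_inv, inv_div]
          have h2 := Real.log_two_gt_d9
          have h3 : 1 / 2 * (n * ε / 2) ≤ Real.log 2 * (n * ε / 2) := by
            gcongr
            linarith
          rw [h1]
          linarith
      _ = 2 ^ n * (δ / 4) := by rw [Real.exp_log (by positivity)]

end UniformDeviation

/-! ### From counts to probabilities -/

section Transfer

open Finset

theorem IsUniformSample.measureReal_mem_le {Ω X : Type*} [MeasurableSpace Ω] [Fintype X]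
    {P : Measure Ω} [IsProbabilityMeasure P] {n : ℕ} {ξ : Fin n → Ω → X}
    (hξ : IsUniformSample P ξ) (bad : Finset (Fin n → X)) :
    P.real {ω | (fun i => ξ i ω) ∈ bad} ≤ #bad / (Fintype.card X : ℝ) ^ n := by
  have hset : {ω | (fun i => ξ i ω) ∈ bad} = ⋃ S ∈ bad, {ω | (fun i => ξ i ω) = S} := by
    ext ω
    simp
  have hpt : ∀ S : Fin n → X,
      P.real {ω | (fun i => ξ i ω) = S} = (1 / (Fintype.card X : ℝ)) ^ n := by
    intro S
    have h1 : {ω | (fun i => ξ i ω) = S} = ⋂ i ∈ univ, ξ i ⁻¹' {S i} := by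
      ext ω
      simp [funext_iff]
    have h2 := hξ.indep.measure_inter_preimage_eq_mul univ
      (sets := fun i => {S i}) (fun _ _ => trivial)
    rw [h1, measureReal_def, h2, ENNReal.toReal_prod]
    have h3 : ∀ i, (P (ξ i ⁻¹' {S i})).toReal = 1 / (Fintype.card X : ℝ) :=
      fun i => hξ.uniform i (S i)
    simp [h3]
  rw [hset]
  refine (measureReal_biUnion_finset_le _ _).trans_eq ?_
  simp only [hpt, sum_const, nsmul_eq_mul]
  rw [one_div, inv_pow, div_eq_mul_inv]

theorem misclassifiedFraction_eq {A ι : Type*} [Fintype ι] (F : A → Bool) (x : ι → A)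
    (y : ι → Bool) :
    misclassifiedFraction F x y = trueCount (fun i => F (x i) ^^ y i) / Fintype.card ι := by
  rw [misclassifiedFraction, trueCount, sum_boole]
  congr 3
  ext i
  simp

theorem net_sample_size_bounds {ν : ℕ} (hν : 1 ≤ ν) {ε δ : ℝ} (hε : 0 < ε) (hε1 : ε < 1)
    (hδ : 0 < δ) (hδ1 : δ < 1) (hεδ : ε * δ ≤ 1 / 2) {n : ℝ}
    (hn : 20000 * ((ν : ℝ) / ε * Real.log (1 / (ε * δ))) ≤ n) :
    8 * (ν * Real.log (16 / ε) + Real.log (4 / δ)) ≤ n * ε ∧ 8 ≤ n * ε := by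
  have hν' : (1 : ℝ) ≤ ν := by exact_mod_cast hν
  set L := Real.log (1 / (ε * δ)) with hL
  have hn' : 20000 * (ν * L) ≤ n * ε := by
    have := mul_le_mul_of_nonneg_right hn hε.le
    refine le_trans (le_of_eq ?_) this
    field_simp
  have hlog2 := Real.log_two_gt_d9
  have hL2 : Real.log 2 ≤ L := by
    refine Real.log_le_log two_pos ?_
    rw [le_div_iff₀ (by positivity)]
    linarith
  have hLsum : L = -Real.log ε + -Real.log δ := by
    rw [hL, one_div, Real.log_inv, Real.log_mul hε.ne' hδ.ne']
    ring
  have hε0 := Real.log_neg hε hε1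
  have hδ0 := Real.log_neg hδ hδ1
  have h16 : Real.log (16 / ε) = 4 * Real.log 2 - Real.log ε := by
    rw [Real.log_div (by norm_num) hε.ne', show (16 : ℝ) = 2 ^ 4 by norm_num, Real.log_pow]
    norm_num
  have h4 : Real.log (4 / δ) = 2 * Real.log 2 - Real.log δ := by
    rw [Real.log_div (by norm_num) hδ.ne', show (4 : ℝ) = 2 ^ 2 by norm_num, Real.log_pow]
    norm_num
  have hνL : L ≤ ν * L := le_mul_of_one_le_left (by linarith) hν'
  have h5 : (ν : ℝ) * Real.log (16 / ε) ≤ ν * (5 * L) := by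
    gcongr
    linarith
  constructor <;> linarith

theorem approximation_sample_size_bound {ν : ℕ} (hν : 1 ≤ ν) {ε δ : ℝ} (hε : 0 < ε)
    (hδ : 0 < δ) (hδ1 : δ < 1) {n : ℝ}
    (hn : 20000 * (1 / ε ^ 2 * ((ν : ℝ) + Real.log (1 / δ))) ≤ n) :
    1024 * (12 * ν + Real.log (8 / δ)) ≤ n * ε ^ 2 := by
  have hν' : (1 : ℝ) ≤ ν := by exact_mod_cast hν
  have hn' : 20000 * ((ν : ℝ) + Real.log (1 / δ)) ≤ n * ε ^ 2 := by
    have := mul_le_mul_of_nonneg_right hn (sq_nonneg ε)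
    refine le_trans (le_of_eq ?_) this
    field_simp
  have hlog2 := Real.log_two_lt_d9
  have hδ0 := Real.log_neg hδ hδ1
  have h8 : Real.log (8 / δ) = 3 * Real.log 2 - Real.log δ := by
    rw [Real.log_div (by norm_num) hδ.ne', show (8 : ℝ) = 2 ^ 3 by norm_num, Real.log_pow]
    norm_num
  rw [one_div, Real.log_inv] at hn'
  linarith

end Transfer

theorem lemma2 :
    ∃ C : ℝ, 0 < C ∧
      ∀ (d : ℕ) (A : Type*) [Finite A] (Q : Quantization d A)
        (𝓕 : Set (A → Bool)) (𝓕' : Set (EuclideanSpace ℝ (Fin d) → Bool))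
        (_ : IsRealExtension Q 𝓕 𝓕')
        (ν : ℕ) (_ : 1 ≤ ν) (_ : vcDimension 𝓕' ≤ (ν : ℕ∞))
        (X : Finset A) (y : X → Bool)
        (ε δ : ℝ) (_ : 0 < ε) (_ : ε < 1) (_ : 0 < δ) (_ : δ < 1) (_ : ε * δ ≤ 1 / 2)
        (n₁ n₂ : ℕ)
        (_ : C * ((ν : ℝ) / ε * Real.log (1 / (ε * δ))) ≤ (n₁ : ℝ))
        (_ : C * (1 / ε ^ 2 * ((ν : ℝ) + Real.log (1 / δ))) ≤ (n₂ : ℝ))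
        (Ω : Type*) [MeasurableSpace Ω] (P : Measure Ω) [IsProbabilityMeasure P]
        (ξ₁ : Fin n₁ → Ω → X) (ξ₂ : Fin n₂ → Ω → X)
        (_ : IsUniformSample P ξ₁) (_ : IsUniformSample P ξ₂),
        1 - δ ≤ P.real {ω |
          (∀ F₁ ∈ 𝓕, (∀ i, F₁ (ξ₁ i ω) = y (ξ₁ i ω)) →
            misclassifiedFraction F₁ (fun x : X => (x : A)) y ≤ ε) ∧
          (∀ F₂ ∈ 𝓕, ∀ η : ℝ,
            misclassifiedFraction F₂ (fun i => (ξ₂ i ω : A)) (fun i => y (ξ₂ i ω)) = η →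
              misclassifiedFraction F₂ (fun x : X => (x : A)) y ≤ η + ε)} := by
  refine ⟨20000, by norm_num, ?_⟩
  intro d A _ Q 𝓕 𝓕' hext ν hν hvc X y ε δ hε hε1 hδ hδ1 hεδ n₁ n₂ hn₁ hn₂ Ω _ P _ ξ₁ ξ₂ hξ₁ hξ₂
  obtain ⟨hnet, hnet8⟩ := net_sample_size_bounds hν hε hε1 hδ hδ1 hεδ hn₁
  have happ := approximation_sample_size_bound hν hε hδ hδ1 hn₂
  have hn₁0 : 0 < n₁ := by
    rcases Nat.eq_zero_or_pos n₁ with rfl | h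
    · norm_num at hnet8
    · exact h
  have hn₂0 : 0 < n₂ := by
    rcases Nat.eq_zero_or_pos n₂ with rfl | h
    · have h1 : 0 ≤ Real.log (8 / δ) := Real.log_nonneg (by rw [le_div_iff₀ hδ]; linarith)
      have h2 : (1 : ℝ) ≤ ν := by exact_mod_cast hν
      norm_num at happ
      linarith
    · exact h
  -- There are draws, so `X` is not empty and its cardinality may be divided by.
  obtain ⟨ω₀⟩ : Nonempty Ω := nonempty_of_isProbabilityMeasure P
  have : Nonempty X := ⟨ξ₁ ⟨0, hn₁0⟩ ω₀⟩
  -- The class of error indicators. Only its containing those of all `F ∈ 𝓕` is needed.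
  set 𝓗 : Set (X → Bool) := (fun G x => G x ^^ y x) ''
    ((fun G => G ∘ fun x : X => Q.r x) '' 𝓕')
  have hvc𝓗 : HasVCBound 𝓗 ν := ((hasVCBound_of_vcDimension_le hvc).comp _).xor y
  have hmem : ∀ F ∈ 𝓕, (fun x : X => F x ^^ y x) ∈ 𝓗 := by
    intro F hF
    obtain ⟨G, hG, hGF⟩ := hext.1 F hF
    exact ⟨_, ⟨G, hG, rfl⟩, by funext x; simp [hGF]⟩
  obtain ⟨bad₁, hcard₁, hbad₁⟩ := exists_small_forall_missed_mean_le hvc𝓗 hε hε1 hδ hnet hnet8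
  obtain ⟨bad₂, hcard₂, hbad₂⟩ := exists_small_forall_mean_le hν hvc𝓗 hn₂0 hε hδ hδ1 happ
  have hN : (0 : ℝ) < Fintype.card X := by exact_mod_cast Fintype.card_pos
  have hP₁ : P.real {ω | (fun i => ξ₁ i ω) ∈ bad₁} ≤ δ / 2 := by
    refine (hξ₁.measureReal_mem_le bad₁).trans ?_
    rwa [div_le_iff₀' (by positivity)]
  have hP₂ : P.real {ω | (fun i => ξ₂ i ω) ∈ bad₂} ≤ δ / 2 := by
    refine (hξ₂.measureReal_mem_le bad₂).trans ?_
    rwa [div_le_iff₀' (by positivity)]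
  set good : Set Ω := {ω |
    (∀ F₁ ∈ 𝓕, (∀ i, F₁ (ξ₁ i ω) = y (ξ₁ i ω)) →
      misclassifiedFraction F₁ (fun x : X => (x : A)) y ≤ ε) ∧
    (∀ F₂ ∈ 𝓕, ∀ η : ℝ,
      misclassifiedFraction F₂ (fun i => (ξ₂ i ω : A)) (fun i => y (ξ₂ i ω)) = η →
        misclassifiedFraction F₂ (fun x : X => (x : A)) y ≤ η + ε)}
  have hcover : (Set.univ : Set Ω) ⊆ good ∪
      ({ω | (fun i => ξ₁ i ω) ∈ bad₁} ∪ {ω | (fun i => ξ₂ i ω) ∈ bad₂}) := by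
    intro ω _
    by_contra hω
    simp only [Set.mem_union, Set.mem_ofPred_eq, not_or] at hω
    obtain ⟨hω, hω₁, hω₂⟩ := hω
    refine hω ⟨fun F hF hcons => ?_, fun F hF η hη => ?_⟩
    · rw [misclassifiedFraction_eq]
      exact hbad₁ _ hω₁ _ (hmem F hF) fun i => by simp [hcons i]
    · rw [← hη, misclassifiedFraction_eq, misclassifiedFraction_eq, Fintype.card_fin]
      exact hbad₂ _ hω₂ _ (hmem F hF)
  have h1 : P.real Set.univ ≤ P.real good + (P.real {ω | (fun i => ξ₁ i ω) ∈ bad₁} +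
      P.real {ω | (fun i => ξ₂ i ω) ∈ bad₂}) :=
    (measureReal_mono hcover).trans <| (measureReal_union_le _ _).trans <| by
      gcongr
      exact measureReal_union_le _ _
  rw [probReal_univ] at h1
  linarith
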